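/- All rings are associative with unity, modules are left modules, and ideals are left ideals. Let $R$ be a ring. For an infinite cardinal $\mu$, $R$ is *left $(<\mu)$-noetherian* if every left ideal of $R$ is generated by fewer than $\mu$ elements. Write $\|M\|$ for the cardinality of a module $M$. A module $M$ is *universal over* a submodule $N$ if $\|M\|=\|N\|$ and for every module $N^*\supseteq N$ (with $N$ a submodule of $N^*$) such that $\|N^*\|=\|M\|$ there is an injective homomorphism $N^*\to M$ that is the identity on $N$. For an infinite cardinal $\lambda$ and a limit ordinal $0<\alpha<\lambda^+$, a module $M$ is a *$(\lambda,\alpha)$-limit model* if $M=\bigcup_{i<\alpha}M_i$ for an increasing chain $(M_i)_{i<\alpha}$ of submodules of cardinality $\lambda$ which is continuous (that is, $M_i=\bigcup_{j<i}M_j$ for every limit ordinal $0<i<\alpha$) and such that $M_{i+1}$ is universal over $M_i$ for every $i<\alpha$. A *$\lambda$-limit model* is a $(\lambda,\alpha)$-limit model for some limit ordinal $0<\alpha<\lambda^+$. The abstract elementary class of left $R$-modules with embeddings is *stable in $\lambda$* if there is a $\lambda$-limit model. **Lemma.** Let $\kappa$ be an infinite cardinal, regarded also as an initial ordinal, and let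 $\kappa+1$ be its ordinal successor. If $R$ is left $(<\aleph_{\kappa+1})$-noetherian but not left $(<\aleph_\kappa)$-noetherian, then for every cardinal $\lambda\geq(\operatorname{card}(R)+\aleph_0)^+$ such that the class of left $R$-modules with embeddings is stable in $\lambda$, there are exactly $\kappa$ $\lambda$-limit models up to isomorphism of $R$-modules. -/

import Mathlib

open scoped Cardinal

universe u

namespace LimitModels

/-- A left ideal `I` is `(<κ)`-generated if it is generated by fewer than `κ` elements. -/
def IsLTGenerated {R : Type u} [Ring R] (κ : Cardinal.{u}) (I : Ideal R) : Prop :=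
  ∃ s : Set R, #s < κ ∧ Ideal.span s = I

/-- `R` is left `(<κ)`-noetherian if every left ideal of `R` is `(<κ)`-generated.
(`Ideal R` is the type of left ideals of `R`.) -/
def IsLeftLTNoetherian (R : Type u) [Ring R] (κ : Cardinal.{u}) : Prop :=
  ∀ I : Ideal R, IsLTGenerated κ I

/-- For submodules `N`, `P` of an ambient module: `P` is universal over `N` if `N ⊆ P`,
`‖N‖ = ‖P‖`, and every extension `N*` of `N` with `‖N*‖ = ‖P‖` embeds into `P` over `N`.
An extension of `N` is given by a module `N*` with an injective linear map `g : N → N*`; that `f`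
fixes `N` pointwise then reads `f (g x) = x` for all `x ∈ N`. -/
def IsUniversalOver {R : Type u} [Ring R] {M : Type u} [AddCommGroup M] [Module R M]
    (P N : Submodule R M) : Prop :=
  N ≤ P ∧ #N = #P ∧
    ∀ (N' : Type u) [AddCommGroup N'] [Module R N'] (g : N →ₗ[R] N'),
      Function.Injective g → #N' = #P →
        ∃ f : N' →ₗ[R] P, Function.Injective f ∧ ∀ x : N, (f (g x) : M) = (x : M)

/-- `M` is a `(lam, α)`-limit model over its submodule `N` (for `lam` a cardinal and
`α < lam⁺` a limit ordinal). The chain is `(C i : i < α)`; the values `C i` for `i ≥ α` play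
no role. -/
def IsLimitModelOver {R : Type u} [Ring R] (lam : Cardinal.{u}) (α : Ordinal.{u})
    {M : Type u} [AddCommGroup M] [Module R M] (N : Submodule R M) : Prop :=
  ℵ₀ ≤ lam ∧ Order.IsSuccLimit α ∧ α < (Order.succ lam).ord ∧
    ∃ C : Ordinal.{u} → Submodule R M,
      (∀ i < α, #(C i) = lam) ∧
      (∀ i j, i ≤ j → j < α → C i ≤ C j) ∧
      (∀ i < α, Order.IsSuccLimit i → (C i : Set M) = ⋃ j < i, (C j : Set M)) ∧
      C 0 = N ∧
      (⋃ i < α, (C i : Set M)) = Set.univ ∧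
      ∀ i < α, IsUniversalOver (C (i + 1)) (C i)

/-- `M` is a `lam`-limit model: a `(lam, α)`-limit model over some `N`, for some limit ordinal
`α < lam⁺`. -/
def IsLimitModel (R : Type u) [Ring R] (lam : Cardinal.{u})
    (M : Type u) [AddCommGroup M] [Module R M] : Prop :=
  ∃ (α : Ordinal.{u}) (N : Submodule R M), IsLimitModelOver lam α N

/-- The class of left `R`-modules with embeddings is stable in `lam` if there is a `lam`-limit
model. -/
def IsStableIn (R : Type u) [Ring R] (lam : Cardinal.{u}) : Prop :=
  ∃ (M : Type u) (_ : AddCommGroup M) (_ : Module R M), IsLimitModel R lam M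

/-- The class of all `lam`-limit models. -/
def LimitModel (R : Type u) [Ring R] (lam : Cardinal.{u}) : Type (u + 1) :=
  {M : ModuleCat.{u} R // IsLimitModel R lam M}

/-- Isomorphism of `lam`-limit models as `R`-modules. -/
def limitModelSetoid (R : Type u) [Ring R] (lam : Cardinal.{u}) : Setoid (LimitModel R lam) where
  r M N := Nonempty (M.1 ≃ₗ[R] N.1)
  iseqv :=
    { refl := fun M => ⟨LinearEquiv.refl R M.1⟩
      symm := fun ⟨e⟩ => ⟨e.symm⟩
      trans := fun ⟨e⟩ ⟨f⟩ => ⟨e.trans f⟩ }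

/-- The isomorphism classes of `lam`-limit models. -/
def LimitModelClasses (R : Type u) [Ring R] (lam : Cardinal.{u}) : Type (u + 1) :=
  Quotient (limitModelSetoid R lam)

end LimitModels

/-! For modules of cardinality `lam`, being universal means realizing all amalgams
(`AmalgamatesOver`). Every limit model is the union of a continuous chain of such extensions that
starts at zero and has length the cofinality of `α`: a resolution. Back-and-forth
(`IsResolution.nonempty_linearEquiv`) makes modules with resolutions of equal length isomorphic, so
a limit model depends only on a regular cardinal `μ`.

The ring detects `μ` through extending maps from left ideals to `R`. Maps from `(<μ)`-generated
ideals extend, because their images are trapped in one term of the chain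
(`IsResolution.exists_extension`). If some ideal is not `(<μ)`-generated, a map on an ideal with at
most `μ` generators can be made to escape every term, and then it does not extend
(`IsResolution.exists_not_extension`).

Hence all `μ ≥ ℵ_ (κ + 1)` give injective models, which absorb one another as summands and coincide;
this leaves at most `|κ + 2| = κ` classes. Conversely, the regular cardinals `ℵ_ (i + 1)` with `i <
κ` are lengths of limit models by stability, and the extension property separates these models. -/

namespace LimitModels

open Cardinal Ordinal
open Order hiding Ideal

/-! ### Universality as realization of amalgams -/

section Amalgamation

variable {R : Type u} [Ring R] {M N : Type u} [AddCommGroup M] [Module R M]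
  [AddCommGroup N] [Module R N]

/-- `P` realizes all amalgams over `N`: every partial linear map from a module `A` of cardinality
at most `lam` to `N` (given by its graph `G`) extends to a linear map `A → P` that takes values in
`N` only on the domain of the partial map. -/
def AmalgamatesOver (lam : Cardinal.{u}) (P N : Submodule R M) : Prop :=
  N ≤ P ∧ ∀ (A : Type u) [AddCommGroup A] [Module R A], #A ≤ lam → ∀ G : Submodule R (A × M),
    (∀ m, (0, m) ∈ G → m = 0) → (∀ p ∈ G, p.2 ∈ N) →
    ∃ h : A →ₗ[R] M, (∀ a, h a ∈ P) ∧ (∀ p ∈ G, h p.1 = p.2) ∧ ∀ a, h a ∈ N → (a, h a) ∈ G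

lemma AmalgamatesOver.mono {lam : Cardinal.{u}} {P P' N N' : Submodule R M}
    (h : AmalgamatesOver lam P N) (hP : P ≤ P') (hN : N' ≤ N) : AmalgamatesOver lam P' N' := by
  refine ⟨hN.trans (h.1.trans hP), fun A _ _ hA G h0 hG => ?_⟩
  obtain ⟨f, hf1, hf2, hf3⟩ := h.2 A hA G h0 fun p hp => hN (hG p hp)
  exact ⟨f, fun a => hP (hf1 a), hf2, fun a ha => hf3 a (hN ha)⟩

lemma mk_prod_le {lam : Cardinal.{u}} (hlam : ℵ₀ ≤ lam) {A B : Type u} (hA : #A ≤ lam)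
    (hB : #B ≤ lam) : #(A × B) ≤ lam := by
  simpa using Cardinal.mul_le_of_le hlam hA hB

/-- Universality embeds the amalgamated sum of `A` and `N` along `G` into `P` over `N`. Injectivity
of this embedding gives the last clause. -/
lemma IsUniversalOver.amalgamatesOver {lam : Cardinal.{u}} (hlam : ℵ₀ ≤ lam)
    {P N : Submodule R M} (h : IsUniversalOver P N) (hP : #P = lam) :
    AmalgamatesOver lam P N := by
  obtain ⟨hNP, hcard, huniv⟩ := h
  refine ⟨hNP, fun A _ _ hA G h0 hG => ?_⟩
  let K : Submodule R (A × N) := G.comap (LinearMap.prodMap LinearMap.id (-N.subtype))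
  have hK : ∀ (a : A) (n : N), (a, n) ∈ K ↔ (a, -(n : M)) ∈ G := fun a n => by simp [K]
  -- The factor `P` only pads the amalgamated sum to cardinality exactly `#P`.
  let g : N →ₗ[R] ((A × N) ⧸ K) × P := (K.mkQ ∘ₗ LinearMap.inr R A N).prod 0
  have hg : Function.Injective g := by
    rw [injective_iff_map_eq_zero]
    intro n hn
    have h1 : K.mkQ (0, n) = 0 := congrArg Prod.fst hn
    rw [Submodule.mkQ_apply, Submodule.Quotient.mk_eq_zero, hK] at h1
    simpa using h0 _ h1
  have hZ : #(((A × N) ⧸ K) × P) = #P := by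
    refine le_antisymm ?_ (mk_le_of_injective (f := fun p : P => ((0 : (A × N) ⧸ K), p))
      fun x y hxy => (Prod.mk.inj hxy).2)
    rw [hP]
    refine mk_prod_le hlam ?_ hP.le
    exact (mk_le_of_surjective K.mkQ_surjective).trans (mk_prod_le hlam hA (hcard.trans hP).le)
  obtain ⟨f, hf, hfg⟩ := huniv _ g hg hZ
  let ι : A →ₗ[R] ((A × N) ⧸ K) × P := (K.mkQ ∘ₗ LinearMap.inl R A N).prod 0
  have key : ∀ (a : A) (n : N), (a, (n : M)) ∈ G ↔ ι a = g n := by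
    intro a n
    have : ι a = g n ↔ K.mkQ (a, 0) = K.mkQ (0, n) := by
      simp [ι, g]
    rw [this, Submodule.mkQ_apply, Submodule.mkQ_apply, Submodule.Quotient.eq]
    simp [hK]
  refine ⟨P.subtype ∘ₗ f ∘ₗ ι, fun a => (f (ι a)).2, fun p hp => ?_, fun a ha => ?_⟩
  · have := (key p.1 ⟨p.2, hG p hp⟩).1 hp
    simpa [this] using hfg ⟨p.2, hG p hp⟩
  · refine (key a ⟨_, ha⟩).2 (hf (Subtype.ext ?_))
    rw [hfg]
    rfl

/-- The partial map is the inverse of `g`. Since `0 ∈ N`, the last clause puts the kernel of the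
extension inside the domain of this map, where it is trivial. -/
lemma AmalgamatesOver.isUniversalOver {lam : Cardinal.{u}} {P N : Submodule R M}
    (h : AmalgamatesOver lam P N) (hP : #P = lam) (hN : #N = lam) : IsUniversalOver P N := by
  refine ⟨h.1, hN.trans hP.symm, fun N' _ _ g hg hN' => ?_⟩
  obtain ⟨f, hf1, hf2, hf3⟩ := h.2 N' (hN'.trans hP).le (LinearMap.range (g.prod N.subtype))
    (by
      rintro m ⟨x, hx⟩
      have h1 : g x = 0 := congrArg Prod.fst hx
      have h2 : (x : M) = m := congrArg Prod.snd hx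
      rw [← h2, hg (h1.trans g.map_zero.symm), Submodule.coe_zero])
    (by
      rintro _ ⟨x, rfl⟩
      exact x.2)
  refine ⟨f.codRestrict P hf1, ?_, fun x => hf2 _ ⟨x, rfl⟩⟩
  rw [injective_iff_map_eq_zero]
  intro a ha
  have ha' : f a = 0 := congrArg Subtype.val ha
  obtain ⟨x, hx⟩ := hf3 a (ha' ▸ N.zero_mem)
  have h1 : g x = a := congrArg Prod.fst hx
  have h2 : (x : M) = f a := congrArg Prod.snd hx
  have h3 : x = 0 := Subtype.ext (h2.trans ha')
  rw [← h1, h3, map_zero]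

/-- The relation "amalgamates over" is transported along injective linear maps. -/
lemma AmalgamatesOver.map {lam : Cardinal.{u}} {P L : Submodule R M}
    (h : AmalgamatesOver lam P L) (φ : P →ₗ[R] N) (hφ : Function.Injective φ)
    (L' : Submodule R N) (hL' : ∀ y, y ∈ L' ↔ ∃ x : P, (x : M) ∈ L ∧ φ x = y) :
    AmalgamatesOver lam (LinearMap.range φ) L' := by
  refine ⟨fun y hy => ?_, fun A _ _ hA G h0 hG => ?_⟩
  · obtain ⟨x, -, rfl⟩ := (hL' y).1 hy
    exact ⟨x, rfl⟩
  have hval : ∀ p ∈ G, ∃ x : P, (x : M) ∈ L ∧ φ x = p.2 := fun p hp => (hL' _).1 (hG p hp)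
  obtain ⟨f, hf1, hf2, hf3⟩ := h.2 A hA
    ((G.comap (LinearMap.prodMap LinearMap.id φ)).map (LinearMap.prodMap LinearMap.id P.subtype))
    (by
      rintro m ⟨⟨a, x⟩, hx, hxm⟩
      obtain ⟨rfl, rfl⟩ := Prod.mk.inj hxm
      have : φ x = 0 := h0 _ hx
      rw [hφ (this.trans φ.map_zero.symm)]
      rfl)
    (by
      rintro _ ⟨⟨a, x⟩, hx, rfl⟩
      obtain ⟨x', hx', hxx'⟩ := hval _ hx
      exact (show x' = x from hφ hxx') ▸ hx')
  refine ⟨φ ∘ₗ f.codRestrict P hf1, fun a => ⟨_, rfl⟩, ?_, ?_⟩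
  · rintro ⟨a, y⟩ hp
    obtain ⟨x, hx, hxy⟩ := hval _ hp
    have := hf2 (a, (x : M)) ⟨(a, x), by simpa [hxy] using hp, rfl⟩
    rw [← hxy]
    exact congrArg φ (Subtype.ext this)
  · intro a ha
    obtain ⟨x, hx, hxy⟩ := (hL' _).1 ha
    have h1 : x = f.codRestrict P hf1 a := hφ hxy
    obtain ⟨⟨a', x'⟩, hx', hxa⟩ := hf3 a (by
      have h2 : (x : M) = f a := congrArg Subtype.val h1
      exact h2 ▸ hx)
    obtain ⟨rfl, h2⟩ := Prod.mk.inj hxa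
    have h3 : x' = f.codRestrict P hf1 a' := Subtype.ext h2
    exact h3 ▸ hx'

lemma AmalgamatesOver.comap {lam : Cardinal.{u}} {P L : Submodule R M}
    (h : AmalgamatesOver lam P L) (φ : N →ₗ[R] M) (hφ : Function.Injective φ)
    (hP : P ≤ LinearMap.range φ) : AmalgamatesOver lam (P.comap φ) (L.comap φ) := by
  refine ⟨Submodule.comap_mono h.1, fun A _ _ hA G h0 hG => ?_⟩
  obtain ⟨f, hf1, hf2, hf3⟩ := h.2 A hA (G.map (LinearMap.prodMap LinearMap.id φ))
    (by
      rintro m ⟨⟨a, x⟩, hx, hxm⟩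
      obtain ⟨rfl, rfl⟩ := Prod.mk.inj hxm
      rw [h0 x hx]
      exact φ.map_zero)
    (by
      rintro _ ⟨⟨a, x⟩, hx, rfl⟩
      exact hG _ hx)
  let e := LinearEquiv.ofInjective φ hφ
  let f' : A →ₗ[R] N := e.symm.toLinearMap ∘ₗ f.codRestrict _ fun a => hP (hf1 a)
  have hf' : ∀ a, φ (f' a) = f a := fun a =>
    congrArg Subtype.val (e.apply_symm_apply (f.codRestrict _ (fun a => hP (hf1 a)) a))
  refine ⟨f', fun a => ?_, fun p hp => hφ ?_, fun a ha => ?_⟩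
  · rw [Submodule.mem_comap, hf']
    exact hf1 a
  · rw [hf']
    exact hf2 _ ⟨p, hp, rfl⟩
  · rw [Submodule.mem_comap, hf'] at ha
    obtain ⟨⟨a', x⟩, hx, hxa⟩ := hf3 a ha
    obtain ⟨rfl, h2⟩ := Prod.mk.inj hxa
    rwa [← hφ (h2.trans (hf' _).symm)]

lemma AmalgamatesOver.exists_injective {lam : Cardinal.{u}} {P L : Submodule R M}
    (h : AmalgamatesOver lam P L) (A : Type u) [AddCommGroup A] [Module R A] (hA : #A ≤ lam) :
    ∃ f : A →ₗ[R] M, Function.Injective f ∧ ∀ a, f a ∈ P := by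
  obtain ⟨f, hf1, -, hf3⟩ := h.2 A hA ⊥ (by simp) (by simp)
  refine ⟨f, (injective_iff_map_eq_zero f).2 fun a ha => ?_, hf1⟩
  simpa [ha] using hf3 a (ha ▸ L.zero_mem)

/-- One step of the back-and-forth: a partial isomorphism extends to a prescribed larger domain. -/
lemma AmalgamatesOver.extend_partialIso {lam : Cardinal.{u}} {P L : Submodule R N}
    (h : AmalgamatesOver lam P L) (D : Submodule R M) (hD : #D ≤ lam)
    (G : Submodule R (M × N)) (h0 : ∀ y, (0, y) ∈ G → y = 0) (h0' : ∀ x, (x, 0) ∈ G → x = 0)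
    (hGD : ∀ p ∈ G, p.1 ∈ D) (hGL : ∀ p ∈ G, p.2 ∈ L) :
    ∃ G' : Submodule R (M × N), G ≤ G' ∧ (∀ y, (0, y) ∈ G' → y = 0) ∧
      (∀ x, (x, 0) ∈ G' → x = 0) ∧ (∀ x, x ∈ D ↔ ∃ y, (x, y) ∈ G') ∧ ∀ p ∈ G', p.2 ∈ P := by
  obtain ⟨f, hf1, hf2, hf3⟩ := h.2 D hD (G.comap (LinearMap.prodMap D.subtype LinearMap.id))
    (fun m hm => h0 m (by simpa using hm)) (fun p hp => hGL _ hp)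
  refine ⟨LinearMap.range (D.subtype.prod f), ?_, ?_, ?_, fun x => ⟨fun hx => ?_, ?_⟩, ?_⟩
  · rintro ⟨x, y⟩ hp
    refine ⟨⟨x, hGD _ hp⟩, Prod.ext rfl (hf2 (⟨x, hGD _ hp⟩, y) hp)⟩
  · rintro y ⟨x, hx⟩
    obtain ⟨h1, rfl⟩ := Prod.mk.inj hx
    have : x = 0 := Subtype.ext h1
    rw [this]
    exact f.map_zero
  · rintro _ ⟨x, hx⟩
    obtain ⟨rfl, h2⟩ := Prod.mk.inj hx
    have h2' : f x = 0 := h2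
    -- The value `0` lies in `L`, so `x` already lies in the domain of `G`.
    have := hf3 x (h2' ▸ L.zero_mem)
    rw [h2'] at this
    exact h0' _ this
  · exact ⟨f ⟨x, hx⟩, ⟨x, hx⟩, rfl⟩
  · rintro ⟨y, x, hx⟩
    obtain ⟨rfl, -⟩ := Prod.mk.inj hx
    exact x.2
  · rintro _ ⟨x, rfl⟩
    exact hf1 x

end Amalgamation

/-- Transfinite construction of a submodule by successive extensions, via Zorn's lemma. -/
lemma exists_submodule_of_transfinite_extension {R W : Type u} [Ring R] [AddCommGroup W]
    [Module R W] (o : Ordinal.{u}) (Q : Ordinal.{u} → Submodule R W → Prop) (h0 : Q 0 ⊥)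
    (hstep : ∀ i < o, ∀ G, Q i G → ∃ G', G ≤ G' ∧ Q (i + 1) G')
    (hlim : ∀ (c : Set (Ordinal.{u} × Submodule R W)) (i : Ordinal.{u}) (G : Submodule R W),
      (∀ p ∈ c, Q p.1 p.2) → i ≤ o → (∀ p ∈ c, p.1 ≤ i) → (∀ j < i, ∃ p ∈ c, j < p.1) →
      (∀ p ∈ c, p.2 ≤ G) → (∀ x ∈ G, ∃ p ∈ c, x ∈ p.2) → Q i G) :
    ∃ G, Q o G := by
  -- The order is on pairs (stage, submodule), so a maximal pair at a stage below `o` is refuted by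
  -- the larger stage `i + 1`.
  obtain ⟨⟨i, G⟩, -, ⟨hio, hQ⟩, hmax⟩ := zorn_le_nonempty₀
    {p : Ordinal.{u} × Submodule R W | p.1 ≤ o ∧ Q p.1 p.2} (fun c hc hchain y hy => by
      have hbdd : BddAbove (Prod.fst '' c) := ⟨o, by
        rintro _ ⟨p, hp, rfl⟩
        exact (hc hp).1⟩
      have hne : (Prod.fst '' c).Nonempty := ⟨_, y, hy, rfl⟩
      have hle : ∀ p ∈ c, p.1 ≤ sSup (Prod.fst '' c) := fun p hp => le_csSup hbdd ⟨p, hp, rfl⟩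
      have hleo : sSup (Prod.fst '' c) ≤ o := csSup_le hne (by
        rintro _ ⟨p, hp, rfl⟩
        exact (hc hp).1)
      have hle' : ∀ p ∈ c, p.2 ≤ sSup (Prod.snd '' c) := fun p hp => le_sSup ⟨p, hp, rfl⟩
      have hdir : DirectedOn (· ≤ ·) (Prod.snd '' c) := by
        rintro _ ⟨p, hp, rfl⟩ _ ⟨q, hq, rfl⟩
        rcases hchain.total hp hq with h | h
        · exact ⟨_, ⟨q, hq, rfl⟩, h.2, le_rfl⟩
        · exact ⟨_, ⟨p, hp, rfl⟩, le_rfl, h.2⟩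
      refine ⟨(sSup (Prod.fst '' c), sSup (Prod.snd '' c)), ⟨hleo, ?_⟩,
        fun p hp => ⟨hle p hp, hle' p hp⟩⟩
      refine hlim c _ _ (fun p hp => (hc hp).2) hleo hle (fun j hj => ?_) hle' fun x hx => ?_
      · obtain ⟨_, ⟨p, hp, rfl⟩, h⟩ := exists_lt_of_lt_csSup hne hj
        exact ⟨p, hp, h⟩
      · obtain ⟨_, ⟨p, hp, rfl⟩, h⟩ :=
          (Submodule.mem_sSup_of_directed ((Set.nonempty_of_mem hy).image _) hdir).1 hx
        exact ⟨p, hp, h⟩) (0, ⊥) ⟨zero_le, h0⟩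
  rcases hio.lt_or_eq with h | rfl
  · obtain ⟨G', hGG', hQ'⟩ := hstep i h G hQ
    have := (hmax (y := (i + 1, G')) ⟨add_one_le_iff.2 h, hQ'⟩
      ⟨(lt_add_one i).le, hGG'⟩).1
    exact absurd this (lt_add_one i).not_ge
  · exact ⟨G, hQ⟩

/-! ### Resolutions and their uniqueness by back-and-forth -/

section Resolution

variable {R : Type u} [Ring R] {M N : Type u} [AddCommGroup M] [Module R M]
  [AddCommGroup N] [Module R N]

/-- A continuous increasing chain of submodules of cardinality at most `lam`, starting at `⊥` and
ending at `⊤` in step `o`, in which each term amalgamates over the preceding one. -/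
structure IsResolution (lam : Cardinal.{u}) (o : Ordinal.{u}) (X : Ordinal.{u} → Submodule R M) :
    Prop where
  mono : Monotone X
  -- This says `X 0 = ⊥` at zero, continuity at limits, and nothing at successors.
  cont : ∀ i x, x ∈ X i → x = 0 ∨ ∃ j < i, x ∈ X (j + 1)
  card_le : ∀ i < o, #(X i) ≤ lam
  amalgamates : ∀ i < o, AmalgamatesOver lam (X (i + 1)) (X i)
  eq_top : X o = ⊤

/-- Two modules with resolutions of the same length are isomorphic. -/
theorem IsResolution.nonempty_linearEquiv {lam : Cardinal.{u}} {o : Ordinal.{u}}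
    (ho : IsSuccLimit o) {X : Ordinal.{u} → Submodule R M} {Y : Ordinal.{u} → Submodule R N}
    (hX : IsResolution lam o X) (hY : IsResolution lam o Y) : Nonempty (M ≃ₗ[R] N) := by
  obtain ⟨G, ⟨h0, h0'⟩, hdom, hran, -⟩ :=
    exists_submodule_of_transfinite_extension o
    -- The partners of newly covered elements land one term further, so the bound `i + 1` is one
    -- ahead of the covered terms `j + 1 ≤ i`.
    (fun i (G : Submodule R (M × N)) =>
      ((∀ y, (0, y) ∈ G → y = 0) ∧ (∀ x, (x, 0) ∈ G → x = 0)) ∧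
      (∀ j < i, ∀ x ∈ X (j + 1), ∃ y, (x, y) ∈ G) ∧
      (∀ j < i, ∀ y ∈ Y (j + 1), ∃ x, (x, y) ∈ G) ∧
      ∀ p ∈ G, p.1 ∈ X (i + 1) ∧ p.2 ∈ Y (i + 1))
    (by
      refine ⟨⟨by simp, by simp⟩, fun j hj => ?_, fun j hj => ?_, by simp⟩
      · exact absurd hj (not_lt_zero)
      · exact absurd hj (not_lt_zero))
    (by
      rintro i hi G ⟨⟨h0, h0'⟩, hdom, hran, hG⟩
      have hi1 : i + 1 < o := ho.add_one_lt hi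
      obtain ⟨G₁, hGG₁, h1, h1', hdom₁, hran₁⟩ :=
        (hY.amalgamates (i + 1) hi1).extend_partialIso (X (i + 1)) (hX.card_le _ hi1) G h0 h0'
          (fun p hp => (hG p hp).1) (fun p hp => (hG p hp).2)
      -- The back step must also cover the range of `G₁`, in order to extend `G₁`.
      have hD : G₁.map (LinearMap.snd R M N) ⊔ Y (i + 1) ≤ Y (i + 1 + 1) := by
        refine sup_le ?_ (hY.mono (lt_add_one _).le)
        rintro _ ⟨p, hp, rfl⟩
        exact hran₁ p hp
      obtain ⟨G₂, hGG₂, h2, h2', hdom₂, hran₂⟩ :=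
        (hX.amalgamates (i + 1) hi1).extend_partialIso
          (G₁.map (LinearMap.snd R M N) ⊔ Y (i + 1))
          ((mk_le_of_injective (Submodule.inclusion_injective hD)).trans
            (hY.card_le _ (ho.add_one_lt hi1)))
          (G₁.comap (LinearEquiv.prodComm R N M).toLinearMap) h1' h1
          (fun p hp => Submodule.mem_sup_left ⟨p.swap, hp, rfl⟩)
          (fun p hp => (hdom₁ _).2 ⟨_, hp⟩)
      refine ⟨G₂.comap (LinearEquiv.prodComm R M N).toLinearMap, fun p hp => ?_,
        ⟨h2', h2⟩, fun j hj x hx => ?_, fun j hj y hy => ?_, fun p hp => ⟨hran₂ _ hp, ?_⟩⟩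
      · exact hGG₂ (show p.swap ∈ _ from hGG₁ hp)
      · obtain ⟨y, hy⟩ := (hdom₁ x).1 (hX.mono (add_one_le_iff.2 hj) hx)
        exact ⟨y, hGG₂ (show ((y, x) : N × M) ∈ _ from hy)⟩
      · obtain ⟨x, hx⟩ := (hdom₂ y).1
          (Submodule.mem_sup_right (hY.mono (add_one_le_iff.2 hj) hy))
        exact ⟨x, hx⟩
      · exact hD ((hdom₂ p.2).2 ⟨_, hp⟩))
    (by
      intro c i G hQ hi hle hlt hcG hGc
      refine ⟨⟨fun y hy => ?_, fun x hx => ?_⟩, fun j hj x hx => ?_, fun j hj y hy => ?_,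
        fun p hp => ?_⟩
      · obtain ⟨p, hp, h⟩ := hGc _ hy
        exact (hQ p hp).1.1 y h
      · obtain ⟨p, hp, h⟩ := hGc _ hx
        exact (hQ p hp).1.2 x h
      · obtain ⟨p, hp, h⟩ := hlt j hj
        obtain ⟨y, hy⟩ := (hQ p hp).2.1 j h x hx
        exact ⟨y, hcG p hp hy⟩
      · obtain ⟨p, hp, h⟩ := hlt j hj
        obtain ⟨x, hx⟩ := (hQ p hp).2.2.1 j h y hy
        exact ⟨x, hcG p hp hx⟩
      · obtain ⟨q, hq, h⟩ := hGc _ hp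
        have hqi : q.1 + 1 ≤ i + 1 := add_le_add_left (hle q hq) 1
        exact ⟨hX.mono hqi ((hQ q hq).2.2.2 p h).1, hY.mono hqi ((hQ q hq).2.2.2 p h).2⟩)
  have hfst : Function.Bijective (LinearMap.fst R M N ∘ₗ G.subtype) := by
    refine ⟨(injective_iff_map_eq_zero _).2 ?_, fun x => ?_⟩
    · rintro ⟨⟨x, y⟩, hp⟩ (rfl : x = 0)
      obtain rfl := h0 y hp
      rfl
    · rcases hX.cont o x (hX.eq_top ▸ Submodule.mem_top) with rfl | ⟨j, hj, hx⟩
      · exact ⟨0, rfl⟩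
      · obtain ⟨y, hy⟩ := hdom j hj x hx
        exact ⟨⟨_, hy⟩, rfl⟩
  have hsnd : Function.Bijective (LinearMap.snd R M N ∘ₗ G.subtype) := by
    refine ⟨(injective_iff_map_eq_zero _).2 ?_, fun y => ?_⟩
    · rintro ⟨⟨x, y⟩, hp⟩ (rfl : y = 0)
      obtain rfl := h0' x hp
      rfl
    · rcases hY.cont o y (hY.eq_top ▸ Submodule.mem_top) with rfl | ⟨j, hj, hy⟩
      · exact ⟨0, rfl⟩
      · obtain ⟨x, hx⟩ := hran j hj y hy
        exact ⟨⟨_, hx⟩, rfl⟩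
  exact ⟨(LinearEquiv.ofBijective _ hfst).symm.trans (LinearEquiv.ofBijective _ hsnd)⟩

end Resolution

/-! ### Resolutions of limit models, extension of maps from ideals, injective models -/

section Existence

variable {R : Type u} [Ring R] {M N : Type u} [AddCommGroup M] [Module R M]
  [AddCommGroup N] [Module R N]

lemma mem_biSup_lt {s : Ordinal.{u} → Submodule R M} (hs : Monotone s) {i : Ordinal.{u}} {x : M} :
    x ∈ ⨆ j, ⨆ _ : j < i, s j ↔ x = 0 ∨ ∃ j < i, x ∈ s j := by
  rcases eq_or_ne i 0 with rfl | hi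
  · simp
  have : Nonempty (Set.Iio i) := ⟨⟨0, pos_iff_ne_zero.2 hi⟩⟩
  have h : (⨆ j, ⨆ _ : j < i, s j) = ⨆ j : Set.Iio i, s j := iSup_subtype'
  rw [h, Submodule.mem_iSup_of_directed _ 
    (show Monotone fun j : Set.Iio i => s j from hs.comp (Subtype.mono_coe _)).directed_le]
  constructor
  · rintro ⟨⟨j, hj⟩, hx⟩
    exact Or.inr ⟨j, hj, hx⟩
  · rintro (rfl | ⟨j, hj, hx⟩)
    · exact ⟨Classical.arbitrary _, zero_mem _⟩
    · exact ⟨⟨j, hj⟩, hx⟩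

lemma biSup_lt_mono (s : Ordinal.{u} → Submodule R M) :
    Monotone fun i => ⨆ j, ⨆ _ : j < i, s j := fun _ _ hij =>
  iSup_mono fun _ => iSup_mono' fun h => ⟨h.trans_le hij, le_rfl⟩

lemma le_biSup_add_one (s : Ordinal.{u} → Submodule R M) (i : Ordinal.{u}) :
    s i ≤ ⨆ j, ⨆ _ : j < i + 1, s j :=
  le_iSup₂_of_le i (lt_add_one i) le_rfl

/-- A `(lam, α)`-limit model has a resolution of length the cofinality of `α`. -/
theorem IsLimitModelOver.exists_isResolution {lam : Cardinal.{u}} {α : Ordinal.{u}}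
    {L : Submodule R M} (h : IsLimitModelOver lam α L) :
    #M ≤ lam ∧ ∃ X : Ordinal.{u} → Submodule R M, IsResolution lam α.cof.ord X := by
  obtain ⟨hlam, hα, hαlam, C, hcard, hmono, -, -, htop, huniv⟩ := h
  refine ⟨?_, ?_⟩
  · rw [← mk_univ, ← htop]
    exact mk_biUnion_le_of_le (lt_succ_iff.1 (lt_ord.1 hαlam)) hlam _ fun i hi => (hcard i hi).le
  obtain ⟨f, hf⟩ := exists_isFundamentalSeq (o := α) rfl
  -- The resolution is `⨆ j < i, s j`, which is continuous by construction. The default `⊤` keeps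
  -- `s` monotone on all ordinals.
  let s : Ordinal.{u} → Submodule R M := fun k =>
    if hk : k < α.cof.ord then C ((f ⟨k, hk⟩).1 + 1) else ⊤
  have hs : ∀ k (hk : k < α.cof.ord), s k = C ((f ⟨k, hk⟩).1 + 1) := fun k hk => dif_pos hk
  have hlt : ∀ k (hk : k < α.cof.ord), (f ⟨k, hk⟩).1 + 1 < α := fun k hk =>
    hα.add_one_lt (f ⟨k, hk⟩).2
  have hs_mono : Monotone s := by
    intro j k hjk
    by_cases hk : k < α.cof.ord
    · rw [hs j (hjk.trans_lt hk), hs k hk]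
      exact hmono _ _ (add_le_add_left (Subtype.coe_le_coe.2 (hf.strictMono.monotone
        (show (⟨j, _⟩ : Set.Iio _) ≤ ⟨k, hk⟩ from hjk))) 1) (hlt k hk)
    · exact le_top.trans_eq (show s k = ⊤ from dif_neg hk).symm
  have hX : ∀ i (hi : i < α.cof.ord), (⨆ j, ⨆ _ : j < i, s j) ≤ C (f ⟨i, hi⟩).1 := fun i hi =>
    iSup₂_le fun j hj => by
      rw [hs j (hj.trans hi)]
      exact hmono _ _ (add_one_le_iff.2 (hf.strictMono (show (⟨j, _⟩ : Set.Iio _) < ⟨i, hi⟩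
        from hj))) (f ⟨i, hi⟩).2
  refine ⟨fun i => ⨆ j, ⨆ _ : j < i, s j, biSup_lt_mono s, fun i x hx => ?_, fun i hi => ?_,
    fun i hi => ?_, ?_⟩
  · exact ((mem_biSup_lt hs_mono).1 hx).imp_right fun ⟨j, hj, hx⟩ =>
      ⟨j, hj, le_biSup_add_one s j hx⟩
  · exact (mk_le_of_injective (Submodule.inclusion_injective (hX i hi))).trans
      (hcard _ (f ⟨i, hi⟩).2).le
  · refine ((huniv _ (f ⟨i, hi⟩).2).amalgamatesOver hlam (hcard _ (hlt i hi))).mono ?_ (hX i hi)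
    rw [← hs i hi]
    exact le_biSup_add_one s i
  · refine Submodule.eq_top_iff'.2 fun x => (mem_biSup_lt hs_mono).2 (Or.inr ?_)
    have hx : x ∈ ⋃ i < α, (C i : Set M) := htop ▸ Set.mem_univ x
    obtain ⟨i, hi, hx⟩ := Set.mem_iUnion₂.1 hx
    obtain ⟨_, ⟨k, rfl⟩, hk⟩ := hf.isCofinal_range ⟨i, hi⟩
    refine ⟨k.1, k.2, ?_⟩
    rw [hs k.1 k.2]
    exact hmono _ _ ((show i ≤ (f k).1 from hk).trans (lt_add_one _).le) (hlt _ k.2) hx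

lemma IsResolution.exists_mem {lam : Cardinal.{u}} {o : Ordinal.{u}} (ho : IsSuccLimit o)
    {X : Ordinal.{u} → Submodule R M} (hX : IsResolution lam o X) (x : M) :
    ∃ i < o, x ∈ X i := by
  rcases hX.cont o x (hX.eq_top ▸ Submodule.mem_top) with rfl | ⟨j, hj, hx⟩
  · exact ⟨0, ho.bot_lt, zero_mem _⟩
  · exact ⟨j + 1, ho.add_one_lt hj, hx⟩

/-- If `M` has a resolution of regular length `μ`, then maps from `(<μ)`-generated ideals to `M`
extend to the whole ring. -/
theorem IsResolution.exists_extension {lam μ : Cardinal.{u}} (hR : #R ≤ lam) (hμ : μ.IsRegular)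
    {X : Ordinal.{u} → Submodule R M} (hX : IsResolution lam μ.ord X) {I : Ideal R}
    (hI : IsLTGenerated μ I) (f : I →ₗ[R] M) :
    ∃ g : R →ₗ[R] M, ∀ x (hx : x ∈ I), g x = f ⟨x, hx⟩ := by
  obtain ⟨s, hs, rfl⟩ := hI
  choose i hi hfi using fun a : s =>
    hX.exists_mem (isSuccLimit_ord hμ.aleph0_le) (f ⟨a, Ideal.subset_span a.2⟩)
  -- By regularity the images of fewer than `μ` generators lie in one term of the chain.
  have hlt : (⨆ a, i a) < μ.ord := iSup_lt_of_lt_cof (hμ.cof_ord.symm ▸ hs) hi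
  have hle : Ideal.span s ≤ ((X (⨆ a, i a)).comap f).map (Submodule.subtype _) :=
    Submodule.span_le.2 fun a ha => ⟨⟨a, Ideal.subset_span ha⟩,
      hX.mono (Ordinal.le_iSup i ⟨a, ha⟩) (hfi ⟨a, ha⟩), rfl⟩
  obtain ⟨g, -, hg, -⟩ := (hX.amalgamates _ hlt).2 R hR
    (LinearMap.range ((Submodule.subtype (Ideal.span s)).prod f))
    (by
      rintro m ⟨x, hx⟩
      obtain ⟨h1, rfl⟩ := Prod.mk.inj hx
      have : x = 0 := Subtype.ext h1
      rw [this]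
      exact f.map_zero)
    (by
      rintro _ ⟨x, rfl⟩
      obtain ⟨x', hx', hxx'⟩ := hle x.2
      have : x' = x := Subtype.ext hxx'
      exact this ▸ hx')
  exact ⟨g, fun x hx => hg _ ⟨⟨x, hx⟩, rfl⟩⟩

/-- Fewer than `μ` elements never span `J`, so a new element of `J` can be chosen at each stage. -/
lemma exists_strictly_increasing_span {μ : Cardinal.{u}} {J : Ideal R}
    (hJ : ¬ IsLTGenerated μ J) :
    ∃ a : Ordinal.{u} → R, ∀ i < μ.ord, a i ∉ Ideal.span (a '' Set.Iio i) := by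
  classical
  let F : ∀ i : Ordinal.{u}, (∀ j < i, R) → R := fun i b =>
    if h : ∃ x ∈ J, x ∉ Ideal.span (Set.range fun j : Set.Iio i => b j.1 j.2) then h.choose else 0
  let a : Ordinal.{u} → R := Ordinal.lt_wf.fix F
  have ha : ∀ i, a i = F i fun j _ => a j := fun i => Ordinal.lt_wf.fix_eq F i
  have hrange : ∀ i, (Set.range fun j : Set.Iio i => a j.1) = a '' Set.Iio i := fun i =>
    (Set.image_eq_range a (Set.Iio i)).symm
  have haJ : ∀ i, a i ∈ J := by
    intro i
    rw [ha]
    by_cases h : ∃ x ∈ J, x ∉ Ideal.span (Set.range fun j : Set.Iio i => a j.1)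
    · rw [show F i (fun j _ => a j) = h.choose from dif_pos h]
      exact h.choose_spec.1
    · rw [show F i (fun j _ => a j) = 0 from dif_neg h]
      exact J.zero_mem
  refine ⟨a, fun i hi => ?_⟩
  have h : ∃ x ∈ J, x ∉ Ideal.span (Set.range fun j : Set.Iio i => a j.1) := by
    by_contra! h
    refine hJ ⟨a '' Set.Iio i, ?_, le_antisymm (Ideal.span_le.2 ?_) fun x hx => hrange i ▸ h x hx⟩
    · rw [← Cardinal.lift_lt.{u, u + 1}]
      refine mk_image_le_lift.trans_lt ?_
      rw [Cardinal.mk_Iio_ordinal, Cardinal.lift_lift, Cardinal.lift_lt]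
      exact lt_ord.1 hi
    · rintro _ ⟨j, -, rfl⟩
      exact haJ j
  rw [ha i, show F i (fun j _ => a j) = h.choose from dif_pos h, ← hrange]
  exact h.choose_spec.2

/-- If some left ideal is not `(<μ)`-generated and `M` has a resolution of length `μ`, then some
map to `M` from an ideal generated by at most `μ` elements does not extend to the whole ring. -/
theorem IsResolution.exists_not_extension {lam μ : Cardinal.{u}} (hR : #R ≤ lam) (hμ : ℵ₀ ≤ μ)
    {X : Ordinal.{u} → Submodule R M} (hX : IsResolution lam μ.ord X) {J : Ideal R}
    (hJ : ¬ IsLTGenerated μ J) :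
    ∃ I : Ideal R, IsLTGenerated (succ μ) I ∧ ∃ f : I →ₗ[R] M,
      ¬ ∃ g : R →ₗ[R] M, ∀ x (hx : x ∈ I), g x = f ⟨x, hx⟩ := by
  have ho : IsSuccLimit μ.ord := isSuccLimit_ord hμ
  obtain ⟨a, ha⟩ := exists_strictly_increasing_span hJ
  have hspan : ∀ {i j}, i ≤ j → Ideal.span (a '' Set.Iio i) ≤ Ideal.span (a '' Set.Iio j) :=
    fun hij => Ideal.span_mono (Set.image_mono (Set.Iio_subset_Iio hij))
  obtain ⟨G, h0, hdom, hG, hnot⟩ := exists_submodule_of_transfinite_extension μ.ord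
    -- `G` is the graph of a map on the span of the earlier `a j` that sends each `a j` outside `X
    -- j`.
    (fun i (G : Submodule R (R × M)) =>
      (∀ y, (0, y) ∈ G → y = 0) ∧ (∀ j < i, ∃ y, (a j, y) ∈ G) ∧
      (∀ p ∈ G, p.1 ∈ Ideal.span (a '' Set.Iio i) ∧ p.2 ∈ X i) ∧
      ∀ j < i, ∀ y, (a j, y) ∈ G → y ∉ X j)
    (by
      refine ⟨by simp, fun j hj => ?_, by simp, fun j hj => ?_⟩
      · exact absurd hj not_lt_zero
      · exact absurd hj not_lt_zero)
    (by
      rintro i hi G ⟨h0, hdom, hG, hnot⟩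
      obtain ⟨h, h1, h2, h3⟩ := (hX.amalgamates i hi).2 (Ideal.span (a '' Set.Iio (i + 1)))
        ((mk_subtype_le _).trans hR)
        (G.comap (LinearMap.prodMap (Submodule.subtype _) LinearMap.id))
        (fun m hm => h0 m (by simpa using hm)) (fun p hp => (hG _ hp).2)
      have hmem : ∀ {j}, j < i + 1 → a j ∈ Ideal.span (a '' Set.Iio (i + 1)) := fun hj =>
        Ideal.subset_span ⟨_, hj, rfl⟩
      refine ⟨LinearMap.range ((Submodule.subtype _).prod h), ?_, ?_, fun j hj => ?_, ?_, ?_⟩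
      · rintro ⟨x, y⟩ hp
        have hx := hspan (lt_add_one i).le (hG _ hp).1
        exact ⟨⟨x, hx⟩, Prod.ext rfl (h2 (⟨x, hx⟩, y) hp)⟩
      · rintro y ⟨x, hx⟩
        obtain ⟨hx0, rfl⟩ := Prod.mk.inj hx
        have : x = 0 := Subtype.ext hx0
        rw [this]
        exact h.map_zero
      · exact ⟨_, ⟨a j, hmem hj⟩, rfl⟩
      · rintro _ ⟨x, rfl⟩
        exact ⟨x.2, h1 x⟩
      · rintro j hj y ⟨x, hx⟩ hy
        obtain ⟨hxa, rfl⟩ := Prod.mk.inj hx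
        have hxa' : (x : R) = a j := hxa
        rcases (lt_add_one_iff.1 hj).lt_or_eq with hji | rfl
        · obtain ⟨y, hy'⟩ := hdom j hji
          refine hnot j hji y hy' ?_
          exact (show h x = y from h2 (x, y) (show ((x : R), y) ∈ G from hxa'.symm ▸ hy')) ▸ hy
        -- A value of `a i` in `X i` would put `a i` in the domain of `G`, hence in the span of its
        -- predecessors.
        · have h4 : ((x : R), h x) ∈ G := h3 x hy
          exact ha j hi (hxa' ▸ (hG _ h4).1))
    (by
      intro c i G hQ hi hle hlt hcG hGc
      refine ⟨fun y hy => ?_, fun j hj => ?_, fun p hp => ?_, fun j hj y hy hyX => ?_⟩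
      · obtain ⟨p, hp, h⟩ := hGc _ hy
        exact (hQ p hp).1 y h
      · obtain ⟨p, hp, h⟩ := hlt j hj
        obtain ⟨y, hy⟩ := (hQ p hp).2.1 j h
        exact ⟨y, hcG p hp hy⟩
      · obtain ⟨q, hq, h⟩ := hGc _ hp
        exact ⟨hspan (hle q hq) ((hQ q hq).2.2.1 p h).1,
          hX.mono (hle q hq) ((hQ q hq).2.2.1 p h).2⟩
      · obtain ⟨q, hq, h⟩ := hGc _ hy
        by_cases hjq : j < q.1
        · exact (hQ q hq).2.2.2 j hjq y h hyX
        · exact ha j (hj.trans_le hi) (hspan (not_lt.1 hjq) ((hQ q hq).2.2.1 _ h).1))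
  refine ⟨Ideal.span (a '' Set.Iio μ.ord), ⟨_, lt_succ_iff.2 ?_, rfl⟩, ?_⟩
  · rw [← Cardinal.lift_le.{u + 1, u}]
    refine mk_image_le_lift.trans_eq ?_
    rw [Cardinal.mk_Iio_ordinal, Cardinal.lift_lift, card_ord]
  let e : G →ₗ[R] Ideal.span (a '' Set.Iio μ.ord) :=
    (LinearMap.fst R R M ∘ₗ G.subtype).codRestrict _ fun p => (hG _ p.2).1
  have he : Function.Bijective e := by
    refine ⟨(injective_iff_map_eq_zero _).2 ?_, fun x => ?_⟩
    · rintro ⟨⟨x, y⟩, hp⟩ hx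
      obtain rfl : x = 0 := congrArg Subtype.val hx
      obtain rfl := h0 y hp
      rfl
    · have hle : Ideal.span (a '' Set.Iio μ.ord) ≤ G.map (LinearMap.fst R R M) := by
        refine Submodule.span_le.2 ?_
        rintro _ ⟨j, hj, rfl⟩
        obtain ⟨y, hy⟩ := hdom j hj
        exact ⟨_, hy, rfl⟩
      obtain ⟨p, hp, hpx⟩ := hle x.2
      exact ⟨⟨p, hp⟩, Subtype.ext hpx⟩
  let e' := LinearEquiv.ofBijective e he
  refine ⟨LinearMap.snd R R M ∘ₗ G.subtype ∘ₗ e'.symm.toLinearMap, ?_⟩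
  rintro ⟨g, hg⟩
  -- If `g 1 ∈ X j`, then `g (a j) = a j • g 1` lies in `X j` too, which `hnot` forbids.
  obtain ⟨j, hj, hm⟩ := hX.exists_mem ho (g 1)
  have haj : a j ∈ Ideal.span (a '' Set.Iio μ.ord) := Ideal.subset_span ⟨j, hj, rfl⟩
  have h1 : ((e'.symm ⟨a j, haj⟩ : G) : R × M).1 = a j :=
    congrArg Subtype.val (e'.apply_symm_apply ⟨a j, haj⟩)
  refine hnot j hj ((e'.symm ⟨a j, haj⟩ : G) : R × M).2 ?_ ?_
  · exact (show (e'.symm ⟨a j, haj⟩ : G).1 = (a j, (e'.symm ⟨a j, haj⟩ : G).1.2) from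
      Prod.ext h1 rfl) ▸ (e'.symm ⟨a j, haj⟩ : G).2
  · have h2 : g (a j) = ((e'.symm ⟨a j, haj⟩ : G) : R × M).2 := hg _ haj
    rw [← h2, ← mul_one (a j), ← _root_.smul_eq_mul, map_smul]
    exact (X j).smul_mem _ hm

/-- Adding an injective summand preserves resolutions. -/
theorem IsResolution.prod {lam : Cardinal.{u}} (hlam : ℵ₀ ≤ lam) {o : Ordinal.{u}} (ho : o ≠ 0)
    {X : Ordinal.{u} → Submodule R M} (hX : IsResolution lam o X) (hN : Module.Baer R N)
    (hNcard : #N ≤ lam) :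
    IsResolution lam o fun i => (X i).prod (if i = 0 then (⊥ : Submodule R N) else ⊤) := by
  have hle : ∀ i, (X i).prod (if i = 0 then (⊥ : Submodule R N) else ⊤) ≤ (X i).prod ⊤ := fun i =>
    Submodule.prod_mono le_rfl le_top
  refine ⟨fun i j hij => Submodule.prod_mono (hX.mono hij) ?_, ?_, fun i hi => ?_, fun i hi => ?_,
    ?_⟩
  · split_ifs with h1 h2
    · exact le_rfl
    · exact bot_le
    · exact absurd (le_antisymm (hij.trans_eq ‹_›) zero_le) h1
    · exact le_rfl
  · rintro i ⟨x, n⟩ ⟨hx, hn⟩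
    dsimp only at hx hn
    rcases eq_or_ne i 0 with rfl | hi
    · rcases hX.cont 0 x hx with rfl | ⟨j, hj, -⟩
      · left
        have : n = 0 := by simpa using hn
        rw [this]
        rfl
      · exact absurd hj not_lt_zero
    · right
      rcases hX.cont i x hx with rfl | ⟨j, hj, hx⟩
      · exact ⟨0, pos_iff_ne_zero.2 hi, zero_mem _, by simp⟩
      · exact ⟨j, hj, hx, by simp⟩
  · refine le_trans (mk_le_of_injective (β := X i × N)
      (f := fun p => (⟨p.1.1, p.2.1⟩, p.1.2)) fun p q hpq => ?_)
      (mk_prod_le hlam (hX.card_le i hi) hNcard)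
    obtain ⟨h1, h2⟩ := Prod.mk.inj hpq
    exact Subtype.ext (Prod.ext (congrArg Subtype.val h1) h2)
  · refine ⟨Submodule.prod_mono (hX.mono (lt_add_one i).le) ?_, fun A _ _ hA G h0 hG => ?_⟩
    · rw [if_neg (c := i + 1 = 0) (by simp)]
      exact le_top
    have hinj : Function.Injective (LinearMap.fst R A (M × N) ∘ₗ G.subtype) := by
      refine (injective_iff_map_eq_zero _).2 ?_
      rintro ⟨⟨x, y⟩, hp⟩ (rfl : x = 0)
      obtain rfl := h0 y hp
      rfl
    -- Injectivity extends the `N`-component; the `M`-component alone secures the last clause of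
    -- amalgamation.
    obtain ⟨h₂, hh₂⟩ := hN.extension_property _ hinj
      (LinearMap.snd R M N ∘ₗ LinearMap.snd R A (M × N) ∘ₗ G.subtype)
    obtain ⟨h₁, hP, hext, hdom⟩ := (hX.amalgamates i hi).2 A hA
      (G.map (LinearMap.prodMap LinearMap.id (LinearMap.fst R M N)))
      (by
        rintro m ⟨⟨x, y⟩, hp, hx⟩
        obtain ⟨rfl, rfl⟩ := Prod.mk.inj hx
        rw [h0 y hp]
        rfl)
      (by
        rintro _ ⟨p, hp, rfl⟩
        exact (hG p hp).1)
    have hsnd : ∀ p ∈ G, h₂ p.1 = p.2.2 := fun p hp => LinearMap.congr_fun hh₂ ⟨p, hp⟩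
    refine ⟨h₁.prod h₂, fun a => ⟨hP a, ?_⟩, fun p hp => Prod.ext ?_ (hsnd p hp), fun a ha => ?_⟩
    · rw [if_neg (c := i + 1 = 0) (by simp)]
      exact Submodule.mem_top
    · exact hext _ ⟨p, hp, rfl⟩
    · obtain ⟨⟨a', m, n⟩, hp, hx⟩ := hdom a ha.1
      obtain ⟨rfl, h3⟩ := Prod.mk.inj hx
      have h3' : m = h₁ a' := h3
      have h4 : h₂ a' = n := hsnd _ hp
      subst h3' h4
      exact hp
  · rw [if_neg ho, hX.eq_top, Submodule.prod_top]

/-- Two injective modules with resolutions, possibly of different lengths, are isomorphic. -/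
theorem IsResolution.nonempty_linearEquiv_of_baer {lam : Cardinal.{u}} (hlam : ℵ₀ ≤ lam)
    {o o' : Ordinal.{u}} (ho : IsSuccLimit o) (ho' : IsSuccLimit o')
    {X : Ordinal.{u} → Submodule R M} {Y : Ordinal.{u} → Submodule R N}
    (hX : IsResolution lam o X) (hY : IsResolution lam o' Y) (hM : Module.Baer R M)
    (hN : Module.Baer R N) (hMcard : #M ≤ lam) (hNcard : #N ≤ lam) : Nonempty (M ≃ₗ[R] N) := by
  -- Each module absorbs the other: `M ≃ M × N` and `N ≃ N × M`.
  obtain ⟨e⟩ := hX.nonempty_linearEquiv ho (hX.prod hlam ho.bot_lt.ne' hN hNcard)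
  obtain ⟨e'⟩ := hY.nonempty_linearEquiv ho' (hY.prod hlam ho'.bot_lt.ne' hM hMcard)
  exact ⟨e.trans ((LinearEquiv.prodComm R M N).trans e'.symm)⟩

end Existence

/-! ### Limit models of prescribed length inside a power of an injective module -/

section Construction

variable {R : Type u} [Ring R]

lemma exists_injective_module_embedding (M : Type u) [AddCommGroup M] [Module R M] :
    ∃ (I : Type u) (_ : AddCommGroup I) (_ : Module R I), Module.Baer R I ∧
      ∃ j : M →ₗ[R] I, Function.Injective j :=
  let J : ModuleCat.{u} R := CategoryTheory.Injective.under (ModuleCat.of R M)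
  have : CategoryTheory.Injective (ModuleCat.of R J) :=
    inferInstanceAs (CategoryTheory.Injective (CategoryTheory.Injective.under (ModuleCat.of R M)))
  ⟨J, inferInstance, inferInstance,
    Module.Baer.of_injective (Module.injective_module_of_injective_object R J),
    (CategoryTheory.Injective.ι (ModuleCat.of R M)).hom,
    (ModuleCat.mono_iff_injective _).1 inferInstance⟩

/-- Functions on `ι` supported where the rank function `r` is less than `i`. -/
def supportedBelow (R : Type u) [Ring R] {ι : Type u} (I : Type u) [AddCommGroup I] [Module R I]
    (r : ι → Ordinal.{u}) (i : Ordinal.{u}) : Submodule R (ι → I) where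
  carrier := {f | ∀ t, i ≤ r t → f t = 0}
  add_mem' hf hg t ht := by simp [hf t ht, hg t ht]
  zero_mem' _ _ := rfl
  smul_mem' a f hf t ht := by simp [hf t ht]

lemma supportedBelow_mono {ι I : Type u} [AddCommGroup I] [Module R I] (r : ι → Ordinal.{u}) :
    Monotone (supportedBelow R I r) := fun _ _ hij _ hf t ht => hf t (hij.trans ht)

/-- Inside a large enough injective module, a small submodule has an amalgamating extension. -/
lemma exists_amalgamatesOver {lam : Cardinal.{u}} {M : Type u} [AddCommGroup M] [Module R M]
    {C₁ C₂ : Submodule R M} (hC : AmalgamatesOver lam C₂ C₁) (hC₂ : #C₂ = lam)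
    (hemb : ∀ (A : Type u) [AddCommGroup A] [Module R A], #A ≤ lam →
      ∃ f : A →ₗ[R] M, Function.Injective f ∧ ∀ a, f a ∈ C₁)
    {I : Type u} [AddCommGroup I] [Module R I] (hI : Module.Baer R I) {j : M →ₗ[R] I}
    (hj : Function.Injective j) {ι : Type u} (r : ι → Ordinal.{u}) (t₀ : ι)
    (K : Submodule R (ι → I)) (hK : #K ≤ lam) (hKs : K ≤ supportedBelow R I r (r t₀)) :
    ∃ P : Submodule R (ι → I), P ≤ supportedBelow R I r (r t₀ + 1) ∧ #P = lam ∧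
      AmalgamatesOver lam P K := by
  classical
  obtain ⟨k, hk, hkC⟩ := hemb K hK
  let k₂ : K →ₗ[R] C₂ := k.codRestrict C₂ fun x => hC.1 (hkC x)
  have hk₂ : Function.Injective k₂ := fun x y hxy => hk (congrArg Subtype.val hxy)
  obtain ⟨q₀, hq₀, -⟩ := hemb (C₂ ⧸ LinearMap.range k₂)
    ((mk_le_of_surjective (Submodule.mkQ_surjective _)).trans hC₂.le)
  -- The kernel of `q` is exactly the copy of `K` in `C₂`.
  let q : C₂ →ₗ[R] I := j ∘ₗ q₀ ∘ₗ Submodule.mkQ _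
  have hq : ∀ x, q x = 0 ↔ x ∈ LinearMap.range k₂ := by
    intro x
    rw [← Submodule.Quotient.mk_eq_zero (LinearMap.range k₂), ← map_eq_zero_iff q₀ hq₀,
      ← map_eq_zero_iff j hj]
    rfl
  choose h hh using fun t : ι => hI.extension_property k₂ hk₂ (LinearMap.proj t ∘ₗ K.subtype)
  -- The lower coordinates extend those of `K`, while the fresh coordinate `q` detects elements
  -- outside `K`; together they embed `C₂` over `K`.
  let φ : C₂ →ₗ[R] (ι → I) := LinearMap.pi fun t =>
    if r t = r t₀ then q else if r t < r t₀ then h t else 0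
  have hφk : ∀ x : K, φ (k₂ x) = x := by
    intro x
    ext t
    rw [LinearMap.pi_apply]
    split_ifs with h1 h2
    · rw [(hq _).2 ⟨x, rfl⟩, hKs x.2 t h1.ge]
    · exact LinearMap.congr_fun (hh t) x
    · rw [hKs x.2 t (not_lt.1 h2)]
      rfl
  have hφ : Function.Injective φ := by
    refine (injective_iff_map_eq_zero _).2 fun x hx => ?_
    have h1 : q x = 0 := by
      have := congrFun hx t₀
      rwa [LinearMap.pi_apply, if_pos rfl] at this
    obtain ⟨y, rfl⟩ := (hq x).1 h1
    have h2 : (y : ι → I) = 0 := (hφk y).symm.trans hx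
    rw [show y = 0 from Subtype.ext h2, map_zero]
  refine ⟨LinearMap.range φ, ?_, ?_, ?_⟩
  · rintro _ ⟨x, rfl⟩ t ht
    have ht' : r t₀ < r t := add_one_le_iff.1 ht
    rw [LinearMap.pi_apply, if_neg ht'.ne', if_neg ht'.not_gt]
    rfl
  · rw [← hC₂]
    exact (mk_congr (LinearEquiv.ofInjective φ hφ).toEquiv).symm
  · refine (hC.mono le_rfl (N' := LinearMap.range k) ?_).map φ hφ K fun y => ⟨fun hy => ?_, ?_⟩
    · rintro _ ⟨x, rfl⟩
      exact hkC x
    · exact ⟨k₂ ⟨y, hy⟩, ⟨_, rfl⟩, hφk ⟨y, hy⟩⟩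
    · rintro ⟨x, ⟨z, hz⟩, rfl⟩
      obtain rfl : k₂ z = x := Subtype.ext hz
      rw [hφk]
      exact z.2

/-- If the class of `R`-modules is stable in `lam`, then there are continuous chains of modules of
cardinality `lam`, of any length of cardinality at most `lam`, in which each term amalgamates over
the preceding one. -/
lemma IsStableIn.exists_chain {lam : Cardinal.{u}} (h : IsStableIn R lam) {o : Ordinal.{u}}
    (ho : o.card ≤ lam) :
    ∃ (E : Type u) (_ : AddCommGroup E) (_ : Module R E) (K : Ordinal.{u} → Submodule R E),
      Monotone K ∧ (∀ i x, x ∈ K i → x = 0 ∨ ∃ j < i, x ∈ K (j + 1)) ∧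
      (∀ i ≤ o, #(K i) ≤ lam) ∧ (∀ i < o, #(K (i + 1)) = lam) ∧
      ∀ i < o, AmalgamatesOver lam (K (i + 1)) (K i) := by
  classical
  obtain ⟨M, _, _, α, L, hlam, hα, -, C, hcard, -, -, -, -, huniv⟩ := h
  have h0 : (0 : Ordinal) < α := hα.bot_lt
  have h1 : (0 : Ordinal) + 1 < α := hα.add_one_lt h0
  have h2 : (0 : Ordinal) + 1 + 1 < α := hα.add_one_lt h1
  have hC := (huniv _ h1).amalgamatesOver hlam (hcard _ h2)
  have hemb := ((huniv _ h0).amalgamatesOver hlam (hcard _ h1)).exists_injective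
  obtain ⟨I, _, _, hI, j, hj⟩ := exists_injective_module_embedding (R := R) M
  -- There is one fresh coordinate per stage. The fixed ambient module lets limit stages be plain
  -- suprema.
  let r : o.ToType → Ordinal.{u} := fun t => (ToType.mk.symm t).1
  let S := supportedBelow R I r
  have hF : ∀ (i : Ordinal.{u}) (K : Submodule R (o.ToType → I)), ∃ P, K ≤ P ∧
      (i < o → #K ≤ lam → K ≤ S i → P ≤ S (i + 1) ∧ #P = lam ∧ AmalgamatesOver lam P K) := by
    intro i K
    by_cases hi : i < o ∧ #K ≤ lam ∧ K ≤ S i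
    · have hr : r (ToType.mk ⟨i, hi.1⟩) = i := by simp [r]
      obtain ⟨P, hP⟩ := exists_amalgamatesOver hC (hcard _ h2) hemb hI hj r
        (ToType.mk ⟨i, hi.1⟩) K hi.2.1 (hr.symm ▸ hi.2.2)
      rw [hr] at hP
      exact ⟨P, hP.2.2.1, fun _ _ _ => hP⟩
    · exact ⟨K, le_rfl, fun a b c => absurd ⟨a, b, c⟩ hi⟩
  choose F hKF hF using hF
  let K : Ordinal.{u} → Submodule R (o.ToType → I) :=
    Ordinal.lt_wf.fix fun i b => ⨆ j, ⨆ hj : j < i, F j (b j hj)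
  have hKeq : ∀ i, K i = ⨆ j, ⨆ _ : j < i, F j (K j) := fun i => Ordinal.lt_wf.fix_eq _ i
  have hle : ∀ i, F i (K i) ≤ K (i + 1) := fun i =>
    (le_biSup_add_one (fun i => F i (K i)) i).trans_eq (hKeq (i + 1)).symm
  have hKmono : Monotone K := by
    rw [show K = fun i => ⨆ j, ⨆ _ : j < i, F j (K j) from funext hKeq]
    exact biSup_lt_mono _
  have hsmono : Monotone fun i => F i (K i) := by
    intro i i' hi
    rcases hi.lt_or_eq with hi | rfl
    · exact (hle i).trans ((hKmono (add_one_le_iff.2 hi)).trans (hKF _ _))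
    · exact le_rfl
  have hmem : ∀ i x, x ∈ K i ↔ x = 0 ∨ ∃ j < i, x ∈ F j (K j) := fun i x => by
    rw [hKeq]
    exact mem_biSup_lt hsmono
  have hsucc : ∀ i, K (i + 1) = F i (K i) := fun i => by
    refine le_antisymm (fun x hx => ?_) (hle i)
    rcases (hmem _ x).1 hx with rfl | ⟨j, hj, hx⟩
    · exact zero_mem _
    · exact hsmono (lt_add_one_iff.1 hj) hx
  have key : ∀ i ≤ o, #(K i) ≤ lam ∧ K i ≤ S i := by
    intro i
    induction i using WellFoundedLT.induction with
    | ind i ih =>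
      intro hi
      have hj : ∀ j < i, _ := fun j hj =>
        hF j (K j) (hj.trans_le hi) (ih j hj (hj.le.trans hi)).1 (ih j hj (hj.le.trans hi)).2
      constructor
      · have hsub : (K i : Set (o.ToType → I)) ⊆
            insert 0 (⋃ j < i, (F j (K j) : Set (o.ToType → I))) := fun x hx =>
          ((hmem i x).1 hx).imp_right fun ⟨j, hj, hx⟩ => Set.mem_iUnion₂.2 ⟨j, hj, hx⟩
        refine (mk_le_mk_of_subset hsub).trans (mk_insert_le.trans ?_)
        refine (add_le_add_left (mk_biUnion_le_of_le ((card_le_card hi).trans ho) hlam _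
          fun j h => (hj j h).2.1.le) 1).trans_eq (add_one_eq hlam)
      · intro x hx
        rcases (hmem i x).1 hx with rfl | ⟨j, hji, hx⟩
        · exact zero_mem _
        · exact supportedBelow_mono r (add_one_le_iff.2 hji) ((hj j hji).1 hx)
  have key' : ∀ i (hi : i < o), _ := fun i hi =>
    hF i (K i) hi (key i hi.le).1 (key i hi.le).2
  refine ⟨o.ToType → I, inferInstance, inferInstance, K, hKmono, fun i x hx => ?_,
    fun i hi => (key i hi).1, fun i hi => ?_, fun i hi => ?_⟩
  · exact ((hmem i x).1 hx).imp_right fun ⟨j, hj, hx⟩ => ⟨j, hj, hle j hx⟩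
  · rw [hsucc]
    exact (key' i hi).2.1
  · rw [hsucc]
    exact (key' i hi).2.2

/-- If the class of `R`-modules is stable in `lam`, then there are `(lam, μ)`-limit models for all
infinite cardinals `μ ≤ lam`. -/
theorem IsStableIn.exists_isLimitModelOver {lam μ : Cardinal.{u}} (h : IsStableIn R lam)
    (hμ : ℵ₀ ≤ μ) (hμlam : μ ≤ lam) :
    ∃ (M : Type u) (_ : AddCommGroup M) (_ : Module R M) (L : Submodule R M),
      IsLimitModelOver lam μ.ord L := by
  have ho : IsSuccLimit μ.ord := isSuccLimit_ord hμ
  obtain ⟨E, _, _, K, hmono, hcont, hcard, hcard', hK⟩ :=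
    h.exists_chain (o := μ.ord) ((card_ord μ).trans_le hμlam)
  have h1 : (1 : Ordinal) < μ.ord := by simpa using ho.add_one_lt ho.bot_lt
  -- The chain is reindexed by `1 + i` to skip `K 0 = ⊥`, which is too small; adding on the left
  -- fixes limit indices.
  have hadd : ∀ i < μ.ord, 1 + i < μ.ord := fun i hi => isPrincipal_add_ord hμ h1 hi
  have hle : ∀ i < μ.ord, K (1 + i) ≤ K μ.ord := fun i hi => hmono (hadd i hi).le
  have hj : ∀ j : Ordinal.{u}, j + 1 ≤ 1 + (j + 1) := fun j => le_add_left le_rfl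
  have hCcard : ∀ i < μ.ord, #((K (1 + i)).comap (K μ.ord).subtype) = lam := by
    intro i hi
    rw [mk_congr (Submodule.comapSubtypeEquivOfLe (hle i hi)).toEquiv]
    refine le_antisymm (hcard _ (hadd i hi).le) ?_
    rw [← hcard' 0 ho.bot_lt]
    exact mk_le_of_injective (Submodule.inclusion_injective (hmono (by simp)))
  refine ⟨K μ.ord, inferInstance, inferInstance, _, hμ.trans hμlam, ho,
    ord_lt_ord.2 (lt_succ_iff.2 hμlam), fun i => (K (1 + i)).comap (K μ.ord).subtype,
    hCcard, fun i j hij _ => Submodule.comap_mono (hmono (add_le_add_right hij 1)),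
    fun i hi hlim => ?_, rfl, ?_, fun i hi => ?_⟩
  · refine subset_antisymm (fun x hx => ?_) (Set.iUnion₂_subset fun j hj =>
      Submodule.comap_mono (hmono (add_le_add_right hj.le 1)))
    have hx' : (x : E) ∈ K i := by
      rw [← one_add_of_omega0_le (omega0_le_of_isSuccLimit hlim)]
      exact hx
    rcases hcont i x hx' with h0 | ⟨j, hji, hx⟩
    · exact Set.mem_iUnion₂.2 ⟨0, hlim.bot_lt, (show (x : E) ∈ K (1 + 0) from h0 ▸ zero_mem _)⟩
    · exact Set.mem_iUnion₂.2 ⟨j + 1, hlim.add_one_lt hji, hmono (hj j) hx⟩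
  · refine Set.eq_univ_of_forall fun x => ?_
    rcases hcont _ x x.2 with h0 | ⟨j, hji, hx⟩
    · exact Set.mem_iUnion₂.2 ⟨0, ho.bot_lt, (show (x : E) ∈ K (1 + 0) from h0 ▸ zero_mem _)⟩
    · exact Set.mem_iUnion₂.2 ⟨j + 1, ho.add_one_lt hji, hmono (hj j) hx⟩
  · have hi' := ho.add_one_lt hi
    refine AmalgamatesOver.isUniversalOver ?_ (hCcard _ hi') (hCcard _ hi)
    dsimp only
    rw [← add_assoc]
    refine (hK _ (hadd i hi)).comap _ (K μ.ord).injective_subtype ?_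
    rw [Submodule.range_subtype, add_assoc]
    exact hle _ hi'

end Construction

/-! ### Counting isomorphism classes -/

section Counting

variable {R : Type u} [Ring R]

/-- `lam`-limit models with long chains over a sufficiently noetherian ring are injective. -/
lemma IsResolution.baer {M : Type u} [AddCommGroup M] [Module R M] {lam μ ν : Cardinal.{u}}
    (hR : #R ≤ lam) (hμ : μ.IsRegular) {X : Ordinal.{u} → Submodule R M}
    (hX : IsResolution lam μ.ord X) (hν : IsLeftLTNoetherian R ν) (hνμ : ν ≤ μ) :
    Module.Baer R M := fun I f => by
  obtain ⟨s, hs, hI⟩ := hν I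
  exact hX.exists_extension hR hμ ⟨s, hs.trans_le hνμ, hI⟩ f

/-- With `μ` the length of a resolution, `min μ (ℵ_ o)` determines the class: below `ℵ_ o` by
back-and-forth, from `ℵ_ o` on by injectivity. -/
theorem mk_limitModelClasses_le {o : Ordinal.{u}} (hR : IsLeftLTNoetherian R (ℵ_ o))
    {lam : Cardinal.{u}} (hlam : #R ≤ lam) :
    #(LimitModelClasses R lam) ≤ Cardinal.lift.{u + 1} (o + 1).card := by
  have hex : ∀ q : LimitModelClasses R lam, ∃ μ : Cardinal.{u}, μ.IsRegular ∧ ℵ₀ ≤ lam ∧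
      #q.out.1 ≤ lam ∧ ∃ X : Ordinal.{u} → Submodule R q.out.1, IsResolution lam μ.ord X := by
    intro q
    obtain ⟨α, L, h⟩ := q.out.2
    obtain ⟨hcard, X, hX⟩ := h.exists_isResolution
    exact ⟨α.cof, isRegular_cof h.2.1, h.1, hcard, X, hX⟩
  choose μ hμ hlam0 hcard X hX using hex
  have hinj : Function.Injective fun q =>
      (⟨min (μ q) (ℵ_ o), (le_min (hμ q).aleph0_le (aleph0_le_aleph o)), min_le_right _ _⟩ :
        Set.Icc ℵ₀ (ℵ_ o)) := by
    intro p q hpq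
    have hmin : min (μ p) (ℵ_ o) = min (μ q) (ℵ_ o) := congrArg Subtype.val hpq
    suffices h : Nonempty (p.out.1 ≃ₗ[R] q.out.1) by
      rw [← p.out_eq, ← q.out_eq]
      exact Quotient.sound h
    have hlim : ∀ q, IsSuccLimit (μ q).ord := fun q => isSuccLimit_ord (hμ q).aleph0_le
    by_cases hp : ℵ_ o ≤ μ p
    · have hq : ℵ_ o ≤ μ q := by
        rw [min_eq_right hp] at hmin
        exact hmin ▸ min_le_left _ _
      exact (hX p).nonempty_linearEquiv_of_baer (hlam0 p) (hlim p) (hlim q) (hX q)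
        ((hX p).baer hlam (hμ p) hR hp) ((hX q).baer hlam (hμ q) hR hq) (hcard p) (hcard q)
    · rw [min_eq_left (not_le.1 hp).le] at hmin
      have hq : μ p = μ q := by
        rcases min_choice (μ q) (ℵ_ o) with h | h
        · exact hmin.trans h
        · exact absurd (hmin.trans h).ge hp
      have hXq := hX q
      rw [← hq] at hXq
      exact (hX p).nonempty_linearEquiv (hlim p) hXq
  refine (mk_le_of_injective hinj).trans ?_
  have hsub : Set.Icc ℵ₀ (ℵ_ o) ⊆ (fun i : Ordinal.{u} => ℵ_ i) '' Set.Iio (o + 1) := by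
    rintro c ⟨h1, h2⟩
    obtain ⟨i, rfl⟩ := mem_range_aleph_iff.2 h1
    exact ⟨i, lt_add_one_iff.2 (aleph_le_aleph.1 h2), rfl⟩
  exact (mk_le_mk_of_subset hsub).trans (mk_image_le.trans_eq (Cardinal.mk_Iio_ordinal _))

/-- Resolutions of distinct successor lengths below the noetherianity threshold belong to
non-isomorphic modules. -/
lemma IsResolution.isEmpty_linearEquiv {M N : Type u} [AddCommGroup M] [Module R M]
    [AddCommGroup N] [Module R N] {lam μ ν : Cardinal.{u}} (hR : #R ≤ lam) (hμ : ℵ₀ ≤ μ)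
    (hν : ν.IsRegular) (hμν : μ < ν) (hμR : ¬ IsLeftLTNoetherian R μ)
    {X : Ordinal.{u} → Submodule R M} (hX : IsResolution lam μ.ord X)
    {Y : Ordinal.{u} → Submodule R N} (hY : IsResolution lam ν.ord Y) :
    IsEmpty (M ≃ₗ[R] N) := by
  refine ⟨fun e => ?_⟩
  obtain ⟨J, hJ⟩ := not_forall.1 hμR
  -- `I` has at most `μ < ν` generators, so maps from it to `N` extend.
  obtain ⟨I, ⟨s, hs, hI⟩, f, hf⟩ := hX.exists_not_extension hR hμ hJ
  obtain ⟨g, hg⟩ := hY.exists_extension hR hν ⟨s, hs.trans_le (succ_le_of_lt hμν), hI⟩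
    (e.toLinearMap ∘ₗ f)
  refine hf ⟨e.symm.toLinearMap ∘ₗ g, fun x hx => ?_⟩
  simp [hg x hx]

lemma IsLeftLTNoetherian.mono {μ ν : Cardinal.{u}} (h : IsLeftLTNoetherian R μ) (hμν : μ ≤ ν) :
    IsLeftLTNoetherian R ν := fun I =>
  let ⟨s, hs, hI⟩ := h I
  ⟨s, hs.trans_le hμν, hI⟩

/-- An ideal generates itself. This keeps the required chain lengths at most `lam`. -/
lemma le_mk_of_not_isLeftLTNoetherian {μ : Cardinal.{u}} (h : ¬ IsLeftLTNoetherian R μ) :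
    μ ≤ #R := by
  by_contra! hlt
  exact h fun I => ⟨I, (mk_subtype_le _).trans_lt hlt, Ideal.span_eq I⟩

/-- Successor alephs `ℵ_ (i + 1)` with `i < o` are used because they are regular and still at most
`ℵ_ o`. -/
theorem le_mk_limitModelClasses {o : Ordinal.{u}}
    (hR : ¬ IsLeftLTNoetherian R (ℵ_ o)) {lam : Cardinal.{u}} (hlam : #R ≤ lam)
    (hstable : IsStableIn R lam) :
    Cardinal.lift.{u + 1} o.card ≤ #(LimitModelClasses R lam) := by
  have hle : ∀ i : Set.Iio o, ℵ_ (i.1 + 1) ≤ ℵ_ o := fun i =>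
    aleph_le_aleph.2 (add_one_le_iff.2 i.2)
  have hnot : ∀ i : Set.Iio o, ¬ IsLeftLTNoetherian R (ℵ_ (i.1 + 1)) := fun i h =>
    hR (h.mono (hle i))
  have hex : ∀ i : Set.Iio o, ∃ (M : LimitModel R lam) (X : Ordinal.{u} → Submodule R M.1),
      IsResolution lam (ℵ_ (i.1 + 1)).ord X := by
    intro i
    obtain ⟨M, _, _, L, h⟩ := hstable.exists_isLimitModelOver (aleph0_le_aleph (i.1 + 1))
      ((le_mk_of_not_isLeftLTNoetherian (hnot i)).trans hlam)
    obtain ⟨-, X, hX⟩ := h.exists_isResolution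
    rw [(isRegular_aleph_add_one i.1).cof_ord] at hX
    exact ⟨⟨ModuleCat.of R M, _, L, h⟩, X, hX⟩
  choose M X hX using hex
  have hne : ∀ i j : Set.Iio o, i < j → IsEmpty ((M i).1 ≃ₗ[R] (M j).1) := fun i j hij =>
    (hX i).isEmpty_linearEquiv hlam (aleph0_le_aleph _) (isRegular_aleph_add_one _)
      (aleph_lt_aleph.2 (lt_add_one_iff.2 (add_one_le_iff.2 (show i.1 < j.1 from hij)))) (hnot i) (hX j)
  rw [← Cardinal.mk_Iio_ordinal]
  refine mk_le_of_injective (f := fun i => (Quotient.mk _ (M i) : LimitModelClasses R lam))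
    fun i j hij => ?_
  obtain ⟨e⟩ : Nonempty ((M i).1 ≃ₗ[R] (M j).1) := Quotient.exact hij
  rcases lt_trichotomy i j with h | h | h
  · exact ((hne i j h).false e).elim
  · exact h
  · exact ((hne j i h).false e.symm).elim

end Counting

end LimitModels

theorem lemma3p19 {R : Type u} [Ring R] (κ : Cardinal.{u}) (hκ : ℵ₀ ≤ κ)
    (hR : LimitModels.IsLeftLTNoetherian R (ℵ_ (κ.ord + 1)))
    (hR' : ¬ LimitModels.IsLeftLTNoetherian R (ℵ_ κ.ord))
    (lam : Cardinal.{u}) (hlam : Order.succ (#R + ℵ₀) ≤ lam)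
    (hstable : LimitModels.IsStableIn R lam) :
    #(LimitModels.LimitModelClasses R lam) = Cardinal.lift.{u + 1} κ := by
  have hRlam : #R ≤ lam := le_self_add.trans ((Order.le_succ _).trans hlam)
  refine le_antisymm ?_ ?_
  -- Here `o = κ.ord + 1`, and `κ + 1 + 1 = κ` as `κ` is infinite.
  · refine (LimitModels.mk_limitModelClasses_le hR hRlam).trans_eq ?_
    rw [Ordinal.card_add, Ordinal.card_add, Cardinal.card_ord, Ordinal.card_one,
      Cardinal.add_one_eq hκ, Cardinal.add_one_eq hκ]
  · have := LimitModels.le_mk_limitModelClasses hR' hRlam hstable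
    rwa [Cardinal.card_ord] at this
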